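/- **Setting.** Fix a smoothness order $\beta\ge 2$ and a cost exponent $\gamma>0$. For a dimension $d\ge1$ and constants $L,R,\mu,L_\beta>0$ (gradient-Lipschitz constant, radius, strong convexity modulus, Hölder constant), let $$\mathcal E(N,B,\delta)=\frac{dL^2R^2}{\mu N}+\frac{L_\beta^{2/\beta}}{\mu}\Big(\frac{d^2\delta^2}{BN}\Big)^{\frac{\beta-1}{\beta}}+\frac{d^{1+2/\beta}L^2}{\mu N^{1+1/\beta}}\Big(\frac{\delta^2}{BL_\beta^2}\Big)^{1/\beta}$$ be the convergence bound of the batched $\ell_2$-randomized zeroth-order SGD under strong convexity and Tsybakov noise, where $N\ge1$ is the number of sequential iterations, $B\ge1$ the batch size and $\delta\in(0,1]$ the oracle fidelity. For a target $\varepsilon>0$ consider the wall-clock problem $$T^*(\varepsilon)=\min\{\,BN\delta^{-\gamma}\;:\;\mathcal E(N,B,\delta)\le\varepsilon\,\},$$ either with integers $N,B\ge 1$ or in its continuous relaxation $N,B\in[1,\infty)$. Write $a(\varepsilon)\sim b(\varepsilon)$ for $a(\varepsilon)/b(\varepsilon)\to1$ as $\varepsilon\downarrow0$ with all other parameters fixed;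 for minimizers this is meant uniformly over all minimizers at level $\varepsilon$. Put $$m=\frac{2\beta-2+\gamma}{(\beta-1)(2-\gamma)},\qquad C_\beta(\gamma)=\Big(\frac{\gamma\beta}{2\beta-2+\gamma}\Big)^{\frac{\beta}{2(\beta-1)}}m^{1/2}\qquad(0<\gamma<2).$$ **(a) $0<\gamma<2$.** In both the integer and the continuous problem, a minimizer exists for every $\varepsilon>0$, every minimizer has $B^*=1$, and $$N^*\sim\frac{dL^2R^2}{\mu\varepsilon}\,m,\qquad \delta^*\sim d^{-1/2}LR\,\mu^{\frac1{2(\beta-1)}}L_\beta^{-\frac1{\beta-1}}\varepsilon^{\frac1{2(\beta-1)}}C_\beta(\gamma),$$ $$T^*\sim d^{\frac{2+\gamma}2}L^{2-\gamma}R^{2-\gamma}L_\beta^{\frac{\gamma}{\beta-1}}(\mu\varepsilon)^{-\frac{2\beta-2+\gamma}{2(\beta-1)}}\;m\,C_\beta(\gamma)^{-\gamma}.$$ In particular, there are constants $c,C>0$ depending only on $\beta,\gamma$ such that for all $d,L,R,\mu,L_\beta$ and all sufficiently small $\varepsilon$ (depending on these parameters), $T^*$ lies between $c$ and $C$ times $$d^{\frac{2+\gamma}2}L^{2-\gamma}R^{2-\gamma}L_\beta^{\frac{\gamma}{\beta-1}}\mu^{-\frac{2\beta-2+\gamma}{2(\beta-1)}}\varepsilon^{-\frac{2\beta-2+\gamma}{2(\beta-1)}}C_\beta(\gamma).$$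 **(b) $\gamma\ge2$.** Put $S(\varepsilon)=d^2L_\beta^{2/(\beta-1)}\mu^{-\beta/(\beta-1)}\varepsilon^{-\beta/(\beta-1)}$ and $D(\varepsilon)=dL^2R^2/(\mu\varepsilon)$. 1. In the continuous problem, for every $\varepsilon>0$ a minimizer exists and every minimizer has $\delta^*=1$ and $B^*=1$. 2. In both the integer and the continuous problem minimizers exist for every $\varepsilon>0$, and $T^*(\varepsilon)\sim S(\varepsilon)$. 3. (Sequential.) For every $\eta>0$ and all sufficiently small $\varepsilon$ there is an integer $N$ such that $(N,1,1)$ is feasible and its cost is at most $(1+\eta)$ times the cost of any feasible design, continuous ones included. 4. (Batched.) For all sufficiently small $\varepsilon$ and every integer $N$ with $4D(\varepsilon)\le N\le S(\varepsilon)$ there is an integer $B>1$ such that $(N,B,1)$ is feasible and its cost is at most $5$ times that of any feasible design. In particular, for every $\kappa>0$ and all sufficiently small $\varepsilon$ there are integers $N\le 5D(\varepsilon)$ and $B>1$ with this property for which moreover $N\le\kappa N'$ for every integer $N'$ such that $(N',1,1)$ is feasible. -/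

import Mathlib

open Filter Topology

noncomputable section

/-- Constants of the strongly convex problem: dimension `d`, gradient-Lipschitz constant `L`,
radius `R`, strong convexity modulus `μ`, and Hölder constant `Lβ` of the derivative of order
`⌊β⌋`. -/
structure ProblemConstants where
  d : ℕ
  L : ℝ
  R : ℝ
  μ : ℝ
  Lβ : ℝ
  d_pos : 1 ≤ d
  L_pos : 0 < L
  R_pos : 0 < R
  μ_pos : 0 < μ
  Lβ_pos : 0 < Lβ

/-- A design: number of sequential iterations `N`, batch size `B`, and the (uniform) oracle
fidelity `δ`. -/
@[ext] structure Design where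
  N : ℝ
  B : ℝ
  δ : ℝ

/-- The convergence bound of the batched `ℓ₂`-randomized zeroth-order SGD: the deterministic term,
the main noise channel, and the residual noise channel. -/
def errorBound (P : ProblemConstants) (β : ℝ) (x : Design) : ℝ :=
  (P.d : ℝ) * P.L ^ 2 * P.R ^ 2 / (P.μ * x.N)
    + P.Lβ ^ (2 / β) / P.μ * ((P.d : ℝ) ^ 2 * x.δ ^ 2 / (x.B * x.N)) ^ ((β - 1) / β)
    + (P.d : ℝ) ^ (1 + 2 / β) * P.L ^ 2 / (P.μ * x.N ^ (1 + 1 / β))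
        * (x.δ ^ 2 / (x.B * P.Lβ ^ 2)) ^ (1 / β)

/-- Total wall-clock time (total oracle work): `B * N` queries of cost `δ ^ (-γ)` each. -/
def wallClock (γ : ℝ) (x : Design) : ℝ := x.B * x.N * x.δ ^ (-γ)

/-- Integer iteration counts and batch sizes: `1, 2, 3, …`. -/
def integerCounts : Set ℝ := {t | ∃ n : ℕ, 1 ≤ n ∧ t = n}

/-- The continuous relaxation: iteration counts and batch sizes in `[1, ∞)`. -/
def continuousCounts : Set ℝ := Set.Ici 1

/-- Designs with `N, B` in the prescribed range `S` and `0 < δ ≤ 1` whose error bound is at most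
the target accuracy `ε`. -/
def feasible (P : ProblemConstants) (β : ℝ) (S : Set ℝ) (ε : ℝ) : Set Design :=
  {x | x.N ∈ S ∧ x.B ∈ S ∧ 0 < x.δ ∧ x.δ ≤ 1 ∧ errorBound P β x ≤ ε}

/-- `x` solves the wall-clock problem `min wallClock` subject to `errorBound ≤ ε`. -/
def IsOptimal (P : ProblemConstants) (β γ : ℝ) (S : Set ℝ) (ε : ℝ) (x : Design) : Prop :=
  x ∈ feasible P β S ε ∧ ∀ y ∈ feasible P β S ε, wallClock γ x ≤ wallClock γ y

/-- `m(β, γ) = (2β - 2 + γ) / ((β - 1)(2 - γ))`. -/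
def depthFactor (β γ : ℝ) : ℝ := (2 * β - 2 + γ) / ((β - 1) * (2 - γ))

/-- `C_β(γ)`. -/
def fidelityFactor (β γ : ℝ) : ℝ :=
  (γ * β / (2 * β - 2 + γ)) ^ (β / (2 * (β - 1))) * depthFactor β γ ^ ((1 : ℝ) / 2)

/-- The sequential-depth scale `d L² R² / (μ ε)`. -/
def depthScale (P : ProblemConstants) (ε : ℝ) : ℝ :=
  (P.d : ℝ) * P.L ^ 2 * P.R ^ 2 / (P.μ * ε)

/-- Leading-order iteration count for `0 < γ < 2`. -/
def leadN (P : ProblemConstants) (β γ ε : ℝ) : ℝ := depthScale P ε * depthFactor β γ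

/-- Leading-order fidelity for `0 < γ < 2`. -/
def leadδ (P : ProblemConstants) (β γ ε : ℝ) : ℝ :=
  (P.d : ℝ) ^ (-(1 : ℝ) / 2) * P.L * P.R * P.μ ^ (1 / (2 * (β - 1))) * P.Lβ ^ (-1 / (β - 1))
    * ε ^ (1 / (2 * (β - 1))) * fidelityFactor β γ

/-- Leading-order wall-clock time for `0 < γ < 2`, without the factor depending on `β, γ` only. -/
def timeScale (P : ProblemConstants) (β γ ε : ℝ) : ℝ :=
  (P.d : ℝ) ^ ((2 + γ) / 2) * P.L ^ (2 - γ) * P.R ^ (2 - γ) * P.Lβ ^ (γ / (β - 1))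
    * P.μ ^ (-(2 * β - 2 + γ) / (2 * (β - 1))) * ε ^ (-(2 * β - 2 + γ) / (2 * (β - 1)))

/-- Leading-order wall-clock time for `γ ≥ 2`. -/
def coarseTime (P : ProblemConstants) (β ε : ℝ) : ℝ :=
  (P.d : ℝ) ^ 2 * P.Lβ ^ (2 / (β - 1)) * P.μ ^ (-β / (β - 1)) * ε ^ (-β / (β - 1))

end

/-!
The error bound sees batch size and fidelity only through the effective work `M = B N / δ²`.
With `D = depthScale`, `S = coarseTime`, `q = (β - 1) / β` and a constant `ρ`,

  `errorBound / ε = (D / N) (1 + ρ M ^ (-1 / β)) + (S / M) ^ q`   (`errorBound_eq`),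

so a feasible design satisfies `u + v ≤ 1` for the shares `u = D / N` and `v = (S / M) ^ q` of the
error budget. As `ε → 0`, both `D` and `S` tend to infinity, `D / S` tends to zero, and the residual
factor `ρ M ^ (-1 / β)` vanishes because `M ≥ S`. Optima exist since designs no more expensive than
a given one stay in a compact box (`exists_isOptimal`).

For `γ < 2` it is cheaper to lower the fidelity by `√B` than to use a batch of size `B`, so `B = 1`
(`IsOptimal.sequential`). The cost is then `timeScale * u ^ (-a) * v ^ (-b)` with `a = 1 - γ / 2`
and `b = γ / (2 q)`. On `u + v ≤ 1` this is minimal exactly at `(u, v)` proportional to `(a, b)`, by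
the weighted AM-GM inequality. Its quantitative form `hellinger_le_log_div` bounds the Hellinger
distance to the minimizer by the logarithmic excess cost; explicit integer designs make that excess
vanish (`eventually_exists_wallClock_le`). Hence the shares of all optima converge
(`tendsto_shares`), and depth, fidelity and cost are explicit functions of the shares.

For `γ ≥ 2` the cost is at least `M`, hence at least `S` (`coarseTime_le_wallClock`). Replacing a
design by `(M, 1, 1)` costs no more and strictly improves the error unless the design already has
this form (`IsOptimal.full_fidelity_sequential`). For small `ε`, sequential depth
just above `S` is feasible, and so is every depth `N` between `4 D` and `S` with a batch of size
`⌈4 S / N⌉`.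
-/

noncomputable section

/-! ### Error bound and cost in terms of the effective work -/

/-- The work `B N / δ²` that a design would cost if the price exponent were `2`. The two noise
channels see batch size and fidelity only through this quantity. -/
def effectiveWork (x : Design) : ℝ := x.B * x.N / x.δ ^ 2

/-- Ratio of the coefficients of the residual noise channel and of the deterministic term, when
both are written in terms of the depth and of the effective work. -/
def residualRatio (P : ProblemConstants) (β : ℝ) : ℝ := ((P.d : ℝ) / P.Lβ) ^ (2 / β) / P.R ^ 2

/-- Fraction of the error budget `ε` spent on the deterministic term. -/
def depthShare (P : ProblemConstants) (ε : ℝ) (x : Design) : ℝ := depthScale P ε / x.N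

/-- Fraction of the error budget `ε` spent on the main noise channel. -/
def noiseShare (P : ProblemConstants) (β ε : ℝ) (x : Design) : ℝ :=
  (coarseTime P β ε / effectiveWork x) ^ ((β - 1) / β)

lemma ProblemConstants.cast_d_pos (P : ProblemConstants) : (0 : ℝ) < P.d := by
  exact_mod_cast P.d_pos

lemma effectiveWork_pos {x : Design} (hN : 0 < x.N) (hB : 0 < x.B) (hδ : 0 < x.δ) :
    0 < effectiveWork x := by
  unfold effectiveWork; positivity

lemma residualRatio_pos (P : ProblemConstants) (β : ℝ) : 0 < residualRatio P β := by
  have := P.cast_d_pos; have := P.Lβ_pos; have := P.R_pos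
  unfold residualRatio; positivity

lemma depthScale_pos (P : ProblemConstants) {ε : ℝ} (hε : 0 < ε) : 0 < depthScale P ε := by
  have := P.cast_d_pos; have := P.L_pos; have := P.R_pos; have := P.μ_pos
  unfold depthScale; positivity

lemma coarseTime_pos (P : ProblemConstants) (β : ℝ) {ε : ℝ} (hε : 0 < ε) :
    0 < coarseTime P β ε := by
  have := P.cast_d_pos; have := P.Lβ_pos; have := P.μ_pos
  unfold coarseTime; positivity

lemma timeScale_pos (P : ProblemConstants) (β γ : ℝ) {ε : ℝ} (hε : 0 < ε) :
    0 < timeScale P β γ ε := by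
  have := P.cast_d_pos; have := P.Lβ_pos; have := P.μ_pos; have := P.L_pos; have := P.R_pos
  unfold timeScale; positivity

/-- The error bound relative to the target: each channel depends on the depth and the effective
work only. -/
lemma errorBound_eq (P : ProblemConstants) {β ε : ℝ} (hβ : 1 < β) (hε : 0 < ε) {x : Design}
    (hN : 0 < x.N) (hB : 0 < x.B) (hδ : 0 < x.δ) :
    errorBound P β x = ε * (depthShare P ε x *
      (1 + residualRatio P β * effectiveWork x ^ (-(1 / β))) + noiseShare P β ε x) := by
  obtain ⟨N, B, δ⟩ := x
  obtain ⟨d, L, R, μ, M, hd, hL, hR, hμ, hM⟩ := P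
  unfold errorBound depthShare noiseShare effectiveWork residualRatio depthScale coarseTime
  dsimp only at *
  have hd' : (0 : ℝ) < d := by exact_mod_cast hd
  generalize (d : ℝ) = d' at hd' ⊢
  have hβ0 : β ≠ 0 := by positivity
  have hβ1 : β - 1 ≠ 0 := by linarith
  -- In exponential coordinates the identity of each channel is linear.
  obtain ⟨N, rfl⟩ : ∃ t, N = Real.exp t := ⟨_, (Real.exp_log hN).symm⟩
  obtain ⟨B, rfl⟩ : ∃ t, B = Real.exp t := ⟨_, (Real.exp_log hB).symm⟩
  obtain ⟨δ, rfl⟩ : ∃ t, δ = Real.exp t := ⟨_, (Real.exp_log hδ).symm⟩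
  obtain ⟨d, rfl⟩ : ∃ t, d' = Real.exp t := ⟨_, (Real.exp_log hd').symm⟩
  obtain ⟨L, rfl⟩ : ∃ t, L = Real.exp t := ⟨_, (Real.exp_log hL).symm⟩
  obtain ⟨R, rfl⟩ : ∃ t, R = Real.exp t := ⟨_, (Real.exp_log hR).symm⟩
  obtain ⟨μ, rfl⟩ : ∃ t, μ = Real.exp t := ⟨_, (Real.exp_log hμ).symm⟩
  obtain ⟨M, rfl⟩ : ∃ t, M = Real.exp t := ⟨_, (Real.exp_log hM).symm⟩
  obtain ⟨ε, rfl⟩ : ∃ t, ε = Real.exp t := ⟨_, (Real.exp_log hε).symm⟩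
  simp only [← Real.rpow_natCast, ← Real.exp_mul, ← Real.exp_add, ← Real.exp_sub, mul_add,
    mul_one]
  rw [add_right_comm]
  congr 1
  · congr 1
    · congr 1; ring
    · congr 1; push_cast; field_simp; ring
  · congr 1; push_cast; field_simp; ring

lemma timeScale_eq (P : ProblemConstants) {β ε : ℝ} (γ : ℝ) (hβ : 1 < β) (hε : 0 < ε) :
    timeScale P β γ ε = depthScale P ε ^ (1 - γ / 2) * coarseTime P β ε ^ (γ / 2) := by
  obtain ⟨d, L, R, μ, M, hd, hL, hR, hμ, hM⟩ := P
  unfold timeScale depthScale coarseTime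
  dsimp only at *
  have hd' : (0 : ℝ) < d := by exact_mod_cast hd
  generalize (d : ℝ) = d' at hd' ⊢
  have hβ1 : β - 1 ≠ 0 := by linarith
  obtain ⟨d, rfl⟩ : ∃ t, d' = Real.exp t := ⟨_, (Real.exp_log hd').symm⟩
  obtain ⟨L, rfl⟩ : ∃ t, L = Real.exp t := ⟨_, (Real.exp_log hL).symm⟩
  obtain ⟨R, rfl⟩ : ∃ t, R = Real.exp t := ⟨_, (Real.exp_log hR).symm⟩
  obtain ⟨μ, rfl⟩ : ∃ t, μ = Real.exp t := ⟨_, (Real.exp_log hμ).symm⟩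
  obtain ⟨M, rfl⟩ : ∃ t, M = Real.exp t := ⟨_, (Real.exp_log hM).symm⟩
  obtain ⟨ε, rfl⟩ : ∃ t, ε = Real.exp t := ⟨_, (Real.exp_log hε).symm⟩
  simp only [← Real.rpow_natCast, ← Real.exp_mul, ← Real.exp_add, ← Real.exp_sub]
  congr 1; push_cast; field_simp; ring

lemma leadδ_eq (P : ProblemConstants) {β ε : ℝ} (γ : ℝ) (hβ : 1 < β) (hε : 0 < ε) :
    leadδ P β γ ε =
      (depthScale P ε / coarseTime P β ε) ^ ((1 : ℝ) / 2) * fidelityFactor β γ := by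
  obtain ⟨d, L, R, μ, M, hd, hL, hR, hμ, hM⟩ := P
  unfold leadδ depthScale coarseTime
  dsimp only at *
  have hd' : (0 : ℝ) < d := by exact_mod_cast hd
  generalize (d : ℝ) = d' at hd' ⊢
  have hβ1 : β - 1 ≠ 0 := by linarith
  congr 1
  obtain ⟨d, rfl⟩ : ∃ t, d' = Real.exp t := ⟨_, (Real.exp_log hd').symm⟩
  obtain ⟨L, rfl⟩ : ∃ t, L = Real.exp t := ⟨_, (Real.exp_log hL).symm⟩
  obtain ⟨R, rfl⟩ : ∃ t, R = Real.exp t := ⟨_, (Real.exp_log hR).symm⟩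
  obtain ⟨μ, rfl⟩ : ∃ t, μ = Real.exp t := ⟨_, (Real.exp_log hμ).symm⟩
  obtain ⟨M, rfl⟩ : ∃ t, M = Real.exp t := ⟨_, (Real.exp_log hM).symm⟩
  obtain ⟨ε, rfl⟩ : ∃ t, ε = Real.exp t := ⟨_, (Real.exp_log hε).symm⟩
  simp only [← Real.rpow_natCast, ← Real.exp_mul, ← Real.exp_add, ← Real.exp_sub]
  congr 1; push_cast; field_simp; ring

/-! ### Scales as the target accuracy tends to zero -/

lemma tendsto_coarseTime (P : ProblemConstants) {β : ℝ} (hβ : 1 < β) :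
    Tendsto (coarseTime P β) (𝓝[>] 0) atTop := by
  have := P.cast_d_pos; have := P.Lβ_pos; have := P.μ_pos
  unfold coarseTime
  refine Tendsto.const_mul_atTop (by positivity) ?_
  have : -β / (β - 1) < 0 := div_neg_of_neg_of_pos (by linarith) (by linarith)
  exact tendsto_rpow_neg_nhdsGT_zero this

lemma tendsto_depthScale (P : ProblemConstants) :
    Tendsto (depthScale P) (𝓝[>] 0) atTop := by
  have := P.cast_d_pos; have := P.L_pos; have := P.R_pos; have := P.μ_pos
  have h : depthScale P = fun ε => (P.d : ℝ) * P.L ^ 2 * P.R ^ 2 / P.μ * ε⁻¹ := by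
    funext ε; unfold depthScale; field_simp
  rw [h]
  exact tendsto_inv_nhdsGT_zero.const_mul_atTop (by positivity)

lemma tendsto_depthScale_div_coarseTime (P : ProblemConstants) {β : ℝ} (hβ : 1 < β) :
    Tendsto (fun ε => depthScale P ε / coarseTime P β ε) (𝓝[>] 0) (𝓝 0) := by
  have := P.cast_d_pos; have := P.L_pos; have := P.R_pos; have := P.μ_pos
  have hpos : 0 < 1 / (β - 1) := by have : 0 < β - 1 := by linarith
                                    positivity
  have h0 : Tendsto (fun ε : ℝ => depthScale P 1 / coarseTime P β 1 * ε ^ (1 / (β - 1)))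
      (𝓝[>] 0) (𝓝 0) := by
    have := ((Real.continuousAt_rpow_const 0 (1 / (β - 1)) (Or.inr hpos.le)).tendsto.mono_left
      nhdsWithin_le_nhds : Tendsto (fun ε : ℝ => ε ^ (1 / (β - 1))) (𝓝[>] 0) _)
    rw [Real.zero_rpow hpos.ne'] at this
    simpa using this.const_mul (depthScale P 1 / coarseTime P β 1)
  refine h0.congr' ?_
  filter_upwards [self_mem_nhdsWithin] with ε hε
  have hε : 0 < ε := hε
  have hLβ := P.Lβ_pos
  have e1 : ε ^ (-β / (β - 1)) = (ε ^ (1 / (β - 1)))⁻¹ * ε⁻¹ := by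
    have hβ1 : β - 1 ≠ 0 := by linarith
    rw [← Real.rpow_neg hε.le, ← Real.rpow_neg_one ε, ← Real.rpow_add hε]
    congr 1; field_simp; ring
  unfold depthScale coarseTime
  rw [e1, Real.one_rpow]
  field_simp

/-! ### Feasible designs and existence of optima -/

lemma errorBound_le_iff (P : ProblemConstants) {β ε : ℝ} (hβ : 1 < β) (hε : 0 < ε) {x : Design}
    (hN : 0 < x.N) (hB : 0 < x.B) (hδ : 0 < x.δ) :
    errorBound P β x ≤ ε ↔ depthShare P ε x *
      (1 + residualRatio P β * effectiveWork x ^ (-(1 / β))) + noiseShare P β ε x ≤ 1 := by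
  rw [errorBound_eq P hβ hε hN hB hδ]
  exact mul_le_iff_le_one_right hε

lemma isClosed_counts {S : Set ℝ} (hS : S = integerCounts ∨ S = continuousCounts) :
    IsClosed S := by
  rcases hS with rfl | rfl
  · have : integerCounts = Set.range ((↑) : ℤ → ℝ) ∩ Set.Ici 1 := by
      ext t
      constructor
      · rintro ⟨n, hn, rfl⟩
        exact ⟨⟨n, by simp⟩, by simpa using hn⟩
      · rintro ⟨⟨k, rfl⟩, hk⟩
        have hk : (1 : ℝ) ≤ k := hk
        have hk1 : (1 : ℤ) ≤ k := by exact_mod_cast hk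
        lift k to ℕ using by omega
        exact ⟨k, by omega, by simp⟩
    rw [this]
    exact Int.isClosedEmbedding_coe_real.isClosed_range.inter isClosed_Ici
  · exact isClosed_Ici

lemma one_le_of_mem_counts {S : Set ℝ} (hS : S = integerCounts ∨ S = continuousCounts) {t : ℝ}
    (ht : t ∈ S) : 1 ≤ t := by
  rcases hS with rfl | rfl
  · obtain ⟨n, hn, rfl⟩ := ht
    exact_mod_cast hn
  · exact ht

lemma natCast_mem_counts {S : Set ℝ} (hS : S = integerCounts ∨ S = continuousCounts) {n : ℕ}
    (hn : 1 ≤ n) : (n : ℝ) ∈ S := by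
  rcases hS with rfl | rfl
  · exact ⟨n, hn, rfl⟩
  · show (1 : ℝ) ≤ n
    exact_mod_cast hn

lemma one_mem_counts {S : Set ℝ} (hS : S = integerCounts ∨ S = continuousCounts) :
    (1 : ℝ) ∈ S := by
  simpa using natCast_mem_counts hS (le_refl 1)

/-- At every target accuracy, sequential designs with full fidelity and large depth are feasible. -/
lemma tendsto_errorBound_sequential (P : ProblemConstants) {β : ℝ} (hβ : 1 < β) :
    Tendsto (fun n : ℕ => errorBound P β ⟨n, 1, 1⟩) atTop (𝓝 0) := by
  have hN : Tendsto (fun n : ℕ => (n : ℝ)) atTop atTop := tendsto_natCast_atTop_atTop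
  have hq : 0 < (β - 1) / β := div_pos (by linarith) (by linarith)
  have hp : 0 < 1 / β := one_div_pos.2 (by linarith)
  have e : (fun n : ℕ => errorBound P β ⟨n, 1, 1⟩) =ᶠ[atTop] fun n : ℕ =>
      1 * (depthScale P 1 * (n : ℝ)⁻¹ * (1 + residualRatio P β * (n : ℝ) ^ (-(1 / β)))
        + coarseTime P β 1 ^ ((β - 1) / β) * (n : ℝ) ^ (-((β - 1) / β))) := by
    filter_upwards [eventually_ge_atTop 1] with n hn
    have hn' : (0 : ℝ) < n := by exact_mod_cast hn
    rw [errorBound_eq P hβ one_pos hn' one_pos one_pos]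
    simp only [depthShare, noiseShare, effectiveWork, one_pow, div_one, one_mul]
    rw [Real.div_rpow (coarseTime_pos P β one_pos).le hn'.le,
      Real.rpow_neg hn'.le ((β - 1) / β)]
    rfl
  refine Tendsto.congr' e.symm ?_
  have h1 := tendsto_inv_atTop_zero.comp hN
  have h2 := (tendsto_rpow_neg_atTop hp).comp hN
  have h3 := (tendsto_rpow_neg_atTop hq).comp hN
  have := (((h1.const_mul (depthScale P 1)).mul
    ((h2.const_mul (residualRatio P β)).const_add 1)).add
      (h3.const_mul (coarseTime P β 1 ^ ((β - 1) / β)))).const_mul 1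
  simpa [Function.comp_def] using this

/-- Feasible designs that are no more expensive than a given one stay in a compact box, on which
the error bound and the cost are continuous. -/
theorem exists_isOptimal (P : ProblemConstants) {β γ ε : ℝ} (hβ : 1 < β) (hγ : 0 < γ)
    (hε : 0 < ε) {S : Set ℝ} (hS : S = integerCounts ∨ S = continuousCounts) :
    ∃ x, IsOptimal P β γ S ε x := by
  obtain ⟨n, hnε, hn⟩ := (((tendsto_errorBound_sequential P hβ).eventually (ge_mem_nhds hε)).and
    (eventually_ge_atTop 1)).exists
  have hn1 : (1 : ℝ) ≤ n := by exact_mod_cast hn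
  have hn0 : (0 : ℝ) < n := by linarith
  have hSc := isClosed_counts hS
  let δ₀ : ℝ := (n : ℝ) ^ (-(1 / γ))
  have hδ₀ : 0 < δ₀ := by positivity
  have hδ₀1 : δ₀ ≤ 1 :=
    Real.rpow_le_one_of_one_le_of_nonpos hn1 (by have := one_div_pos.2 hγ; linarith)
  let toD : ℝ × ℝ × ℝ → Design := fun p => ⟨p.1, p.2.1, p.2.2⟩
  let box : Set (ℝ × ℝ × ℝ) := Set.Icc 1 (n : ℝ) ×ˢ Set.Icc 1 (n : ℝ) ×ˢ Set.Icc δ₀ 1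
  have hbox : IsCompact box := isCompact_Icc.prod (isCompact_Icc.prod isCompact_Icc)
  have hpos : ∀ p ∈ box, 0 < p.1 ∧ 0 < p.2.1 ∧ 0 < p.2.2 := by
    rintro ⟨a, b, c⟩ ⟨ha, hb, hc⟩
    exact ⟨one_pos.trans_le ha.1, one_pos.trans_le hb.1, hδ₀.trans_le hc.1⟩
  have hE : ContinuousOn (fun p => errorBound P β (toD p)) box := by
    have hβ0 : 0 < β := by linarith
    have hμ := P.μ_pos
    have hL := P.Lβ_pos
    have hd := P.cast_d_pos
    intro p hp
    obtain ⟨h1, h2, h3⟩ := hpos p hp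
    apply ContinuousAt.continuousWithinAt
    simp only [errorBound, toD]
    have e1 : ContinuousAt (fun p : ℝ × ℝ × ℝ => p.1 ^ (1 + 1 / β)) p :=
      ContinuousAt.rpow_const (by fun_prop) (Or.inl h1.ne')
    refine ((ContinuousAt.div (by fun_prop) (by fun_prop) (by positivity)).add
      (ContinuousAt.mul (by fun_prop) ?_)).add (ContinuousAt.mul
        (ContinuousAt.div (by fun_prop) (by fun_prop) (by positivity)) ?_)
    · exact ContinuousAt.rpow_const (ContinuousAt.div (by fun_prop) (by fun_prop) (by positivity))
        (Or.inl (by positivity))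
    · exact ContinuousAt.rpow_const (ContinuousAt.div (by fun_prop) (by fun_prop) (by positivity))
        (Or.inl (by positivity))
  have hW : ContinuousOn (fun p => wallClock γ (toD p)) box := by
    intro p hp
    obtain ⟨h1, h2, h3⟩ := hpos p hp
    apply ContinuousAt.continuousWithinAt
    simp only [wallClock, toD]
    exact ContinuousAt.mul (by fun_prop) (ContinuousAt.rpow_const (by fun_prop) (Or.inl h3.ne'))
  let K : Set (ℝ × ℝ × ℝ) :=
    (box ∩ (fun p => errorBound P β (toD p)) ⁻¹' Set.Iic ε) ∩ (S ×ˢ S ×ˢ Set.univ)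
  have hKbox : K ⊆ box := fun p hp => hp.1.1
  have hK : IsCompact K := hbox.of_isClosed_subset
    ((hE.preimage_isClosed_of_isClosed hbox.isClosed isClosed_Iic).inter
      (hSc.prod (hSc.prod isClosed_univ))) hKbox
  have h0 : ((n : ℝ), (1 : ℝ), (1 : ℝ)) ∈ K :=
    ⟨⟨⟨⟨hn1, le_rfl⟩, ⟨le_rfl, hn1⟩, ⟨hδ₀1, le_rfl⟩⟩, hnε⟩,
      natCast_mem_counts hS hn, one_mem_counts hS, trivial⟩
  obtain ⟨p, hp, hmin⟩ := hK.exists_isMinOn ⟨_, h0⟩ (hW.mono hKbox)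
  refine ⟨toD p, ⟨hp.2.1, hp.2.2.1, (hpos p hp.1.1).2.2, hp.1.1.2.2.2, hp.1.2⟩, ?_⟩
  rintro ⟨N, B, δ⟩ ⟨hN, hB, hδ, hδ1, hyE⟩
  dsimp only at *
  have hN1 := one_le_of_mem_counts hS hN
  have hB1 := one_le_of_mem_counts hS hB
  by_cases hy : wallClock γ ⟨N, B, δ⟩ ≤ n
  · have hδγ : 1 ≤ δ ^ (-γ) := Real.one_le_rpow_of_pos_of_le_one_of_nonpos hδ hδ1 (by linarith)
    unfold wallClock at hy
    dsimp only at hy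
    have hBN : 1 ≤ B * N := one_le_mul_of_one_le_of_one_le hB1 hN1
    have hBNn : B * N ≤ n := by nlinarith
    have hδn : δ ^ (-γ) ≤ n := by nlinarith
    have hδ0 : δ₀ ≤ δ := by
      have := Real.rpow_le_rpow_of_nonpos (by positivity) hδn
        (show -(1 / γ) ≤ 0 by have := one_div_pos.2 hγ; linarith)
      rwa [← Real.rpow_mul hδ.le, show -γ * -(1 / γ) = 1 by field_simp, Real.rpow_one] at this
    exact hmin (show ((N, B, δ) : ℝ × ℝ × ℝ) ∈ K from
      ⟨⟨⟨⟨hN1, by nlinarith⟩, ⟨hB1, by nlinarith⟩, ⟨hδ0, hδ1⟩⟩, hyE⟩, hN, hB, trivial⟩)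
  · have h := hmin h0
    have h' : wallClock γ (toD p) ≤ wallClock γ ⟨n, 1, 1⟩ := h
    have : wallClock γ ⟨n, 1, 1⟩ = n := by simp [wallClock]
    linarith

/-! ### Facts about feasible designs -/

lemma depthShare_pos (P : ProblemConstants) {ε : ℝ} (hε : 0 < ε) {x : Design} (hN : 0 < x.N) :
    0 < depthShare P ε x := div_pos (depthScale_pos P hε) hN

lemma noiseShare_pos (P : ProblemConstants) (β : ℝ) {ε : ℝ} (hε : 0 < ε) {x : Design}
    (hN : 0 < x.N) (hB : 0 < x.B) (hδ : 0 < x.δ) : 0 < noiseShare P β ε x :=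
  Real.rpow_pos_of_pos (div_pos (coarseTime_pos P β hε) (effectiveWork_pos hN hB hδ)) _

lemma depthShare_add_noiseShare_le_one {P : ProblemConstants} {β ε : ℝ} (hβ : 1 < β) (hε : 0 < ε)
    {x : Design} (hN : 0 < x.N) (hB : 0 < x.B) (hδ : 0 < x.δ) (hx : errorBound P β x ≤ ε) :
    depthShare P ε x + noiseShare P β ε x ≤ 1 := by
  have h := (errorBound_le_iff P hβ hε hN hB hδ).1 hx
  have h1 := residualRatio_pos P β
  have h2 := depthShare_pos P hε hN
  have h3 := effectiveWork_pos hN hB hδ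
  have : 0 ≤ depthShare P ε x * (residualRatio P β * effectiveWork x ^ (-(1 / β))) := by
    positivity
  linarith

lemma coarseTime_le_effectiveWork {P : ProblemConstants} {β ε : ℝ} (hβ : 1 < β) (hε : 0 < ε)
    {x : Design} (hN : 0 < x.N) (hB : 0 < x.B) (hδ : 0 < x.δ) (hx : errorBound P β x ≤ ε) :
    coarseTime P β ε ≤ effectiveWork x := by
  have h := depthShare_add_noiseShare_le_one hβ hε hN hB hδ hx
  have hu := depthShare_pos P hε hN
  have hM := effectiveWork_pos hN hB hδ
  have hq : 0 < (β - 1) / β := div_pos (by linarith) (by linarith)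
  by_contra! hlt
  have : 1 < noiseShare P β ε x := Real.one_lt_rpow ((one_lt_div hM).2 hlt) hq
  linarith

/-- For a price exponent at least `2` the cost dominates the effective work. -/
lemma effectiveWork_le_wallClock {γ : ℝ} (hγ : 2 ≤ γ) {x : Design} (hN : 0 ≤ x.N) (hB : 0 ≤ x.B)
    (hδ : 0 < x.δ) (hδ1 : x.δ ≤ 1) : effectiveWork x ≤ wallClock γ x := by
  unfold effectiveWork wallClock
  have h : x.δ ^ (-(2 : ℝ)) ≤ x.δ ^ (-γ) :=
    Real.rpow_le_rpow_of_exponent_ge hδ hδ1 (by linarith)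
  rw [Real.rpow_neg hδ.le, Real.rpow_two] at h
  rw [div_eq_mul_inv]
  exact mul_le_mul_of_nonneg_left h (mul_nonneg hB hN)

/-- For a price exponent at least `2` no feasible design is cheaper than the coarse time. -/
lemma coarseTime_le_wallClock {P : ProblemConstants} {β γ ε : ℝ} (hβ : 1 < β) (hγ : 2 ≤ γ)
    (hε : 0 < ε) {S : Set ℝ} (hS : S = integerCounts ∨ S = continuousCounts) {x : Design}
    (hx : x ∈ feasible P β S ε) : coarseTime P β ε ≤ wallClock γ x := by
  obtain ⟨hN, hB, hδ, hδ1, hE⟩ := hx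
  have hN := one_pos.trans_le (one_le_of_mem_counts hS hN)
  have hB := one_pos.trans_le (one_le_of_mem_counts hS hB)
  exact (coarseTime_le_effectiveWork hβ hε hN hB hδ hE).trans
    (effectiveWork_le_wallClock hγ hN.le hB.le hδ hδ1)

/-! ### Price exponent at least two -/

@[simp] lemma effectiveWork_full_fidelity (N B : ℝ) : effectiveWork ⟨N, B, 1⟩ = B * N := by
  simp [effectiveWork]

@[simp] lemma wallClock_full_fidelity (γ N B : ℝ) : wallClock γ ⟨N, B, 1⟩ = B * N := by
  simp [wallClock]

/-- Moving all effective work into the depth strictly improves the error bound unless the design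
is sequential with full fidelity; the slack then allows a strictly smaller depth. -/
lemma IsOptimal.full_fidelity_sequential {P : ProblemConstants} {β γ ε : ℝ} (hβ : 1 < β)
    (hγ : 2 ≤ γ) (hε : 0 < ε) {x : Design} (hx : IsOptimal P β γ continuousCounts ε x) :
    x.δ = 1 ∧ x.B = 1 := by
  obtain ⟨⟨hN1, hB1, hδ, hδ1, hE⟩, hmin⟩ := hx
  have hN1 : 1 ≤ x.N := hN1
  have hB1 : 1 ≤ x.B := hB1
  have hN : 0 < x.N := by linarith
  have hB : 0 < x.B := by linarith
  set M := effectiveWork x with hM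
  have hM0 : 0 < M := effectiveWork_pos hN hB hδ
  have hMW : M ≤ wallClock γ x := effectiveWork_le_wallClock hγ hN.le hB.le hδ hδ1
  have hMδ : M * x.δ ^ 2 = x.B * x.N := by
    rw [hM]; unfold effectiveWork; field_simp
  have hδ2 : x.δ ^ 2 ≤ 1 := pow_le_one₀ hδ.le hδ1
  have hNBN : x.N ≤ x.B * x.N := le_mul_of_one_le_left hN.le hB1
  have hBNM : x.B * x.N ≤ M := by rw [← hMδ]; exact mul_le_of_le_one_right hM0.le hδ2
  rcases (hNBN.trans hBNM).eq_or_lt with heq | hlt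
  · have hBN : x.B * x.N = x.N := le_antisymm (by linarith) hNBN
    have hB' : x.B = 1 := by
      have : (x.B - 1) * x.N = 0 := by linarith
      rcases mul_eq_zero.1 this with h | h <;> linarith
    refine ⟨?_, hB'⟩
    have : M * x.δ ^ 2 = M * 1 := by rw [hMδ, hBN, heq, mul_one]
    have h2 : x.δ ^ 2 = 1 := mul_left_cancel₀ hM0.ne' this
    exact (pow_eq_one_iff_of_nonneg hδ.le two_ne_zero).1 h2
  · exfalso
    have hEM : errorBound P β ⟨M, 1, 1⟩ < ε := by
      refine lt_of_lt_of_le ?_ hE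
      rw [errorBound_eq P hβ hε hM0 one_pos one_pos, errorBound_eq P hβ hε hN hB hδ]
      refine mul_lt_mul_of_pos_left ?_ hε
      simp only [noiseShare, effectiveWork_full_fidelity, one_mul, ← hM, depthShare]
      have := residualRatio_pos P β
      have hD := depthScale_pos P hε
      gcongr
    have hcont : ContinuousAt (fun t : ℝ => errorBound P β ⟨t, 1, 1⟩) M := by
      have hμ := P.μ_pos
      simp only [errorBound]
      have e1 : ContinuousAt (fun t : ℝ => t ^ (1 + 1 / β)) M :=
        continuousAt_id.rpow_const (Or.inl hM0.ne')
      refine ((ContinuousAt.div (by fun_prop) (by fun_prop) (by positivity)).add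
        (ContinuousAt.mul (by fun_prop) ?_)).add (ContinuousAt.mul
          (ContinuousAt.div (by fun_prop) (by fun_prop) (by positivity)) (by fun_prop))
      have hd := P.cast_d_pos
      exact ContinuousAt.rpow_const (ContinuousAt.div (by fun_prop) (by fun_prop) (by positivity))
        (Or.inl (by positivity))
    have h1 : ∀ᶠ t in 𝓝[<] M, errorBound P β ⟨t, 1, 1⟩ < ε :=
      (hcont.eventually (gt_mem_nhds hEM)).filter_mono nhdsWithin_le_nhds
    have h2 : ∀ᶠ t in 𝓝[<] M, 1 < t :=
      (lt_mem_nhds (show (1 : ℝ) < M by linarith)).filter_mono nhdsWithin_le_nhds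
    have h3 : ∀ᶠ t in 𝓝[<] M, t < M := self_mem_nhdsWithin
    obtain ⟨t, ⟨htE, ht1⟩, htM⟩ := ((h1.and h2).and h3).exists
    have := hmin ⟨t, 1, 1⟩ ⟨ht1.le, le_refl (1 : ℝ), one_pos, le_rfl, le_of_lt htE⟩
    rw [wallClock_full_fidelity] at this
    linarith

/-- Depth slightly above the coarse time suffices: the deterministic and the residual term are
negligible there. -/
lemma eventually_exists_sequential (P : ProblemConstants) {β η : ℝ} (hβ : 1 < β) (hη : 0 < η) :
    ∀ᶠ ε in 𝓝[>] (0 : ℝ), ∃ n : ℕ, (⟨n, 1, 1⟩ : Design) ∈ feasible P β integerCounts ε ∧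
      (n : ℝ) ≤ (1 + η) * coarseTime P β ε := by
  have hq : 0 < (β - 1) / β := div_pos (by linarith) (by linarith)
  have hp : 0 < 1 / β := one_div_pos.2 (by linarith)
  have hρ := residualRatio_pos P β
  let v : ℝ := (1 + η / 2)⁻¹ ^ ((β - 1) / β)
  have hv : v < 1 := Real.rpow_lt_one (by positivity) (inv_lt_one_of_one_lt₀ (by linarith)) hq
  have hsmall : ∀ᶠ ε in 𝓝[>] (0 : ℝ),
      depthScale P ε / coarseTime P β ε < (1 - v) / (1 + residualRatio P β) :=
    (tendsto_depthScale_div_coarseTime P hβ).eventually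
      (gt_mem_nhds (div_pos (by linarith) (by linarith)))
  filter_upwards [self_mem_nhdsWithin, (tendsto_coarseTime P hβ).eventually_ge_atTop (2 / η),
    (tendsto_coarseTime P hβ).eventually_ge_atTop 1, hsmall] with ε hε hS2 hS1 hDS
  have hε : 0 < ε := hε
  have hS0 := coarseTime_pos P β hε
  have hD0 := depthScale_pos P hε
  set S := coarseTime P β ε
  set D := depthScale P ε
  have hnS : (1 + η / 2) * S ≤ ⌈(1 + η / 2) * S⌉₊ := Nat.le_ceil _
  have hnS' := (Nat.ceil_lt_add_one (show 0 ≤ (1 + η / 2) * S by positivity)).le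
  generalize ⌈(1 + η / 2) * S⌉₊ = n at hnS hnS'
  have hSn : S ≤ n := by nlinarith
  have hn1 : (1 : ℝ) ≤ n := by linarith
  have hn0 : (0 : ℝ) < n := by linarith
  refine ⟨n, ⟨⟨n, by exact_mod_cast hn1, rfl⟩, one_mem_counts (Or.inl rfl), one_pos, le_rfl,
    ?_⟩, ?_⟩
  · rw [errorBound_le_iff P hβ hε hn0 one_pos one_pos]
    simp only [depthShare, noiseShare, effectiveWork_full_fidelity, one_mul]
    have h1 : D / n ≤ D / S := div_le_div_of_nonneg_left hD0.le hS0 hSn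
    have h2 : (n : ℝ) ^ (-(1 / β)) ≤ 1 := Real.rpow_le_one_of_one_le_of_nonpos hn1 (by linarith)
    have h3 : (S / n) ^ ((β - 1) / β) ≤ v := by
      refine Real.rpow_le_rpow (by positivity) ?_ hq.le
      rw [div_le_iff₀ hn0, inv_mul_eq_div, le_div_iff₀ (by positivity)]
      linarith
    have h4 : D / n * (1 + residualRatio P β * (n : ℝ) ^ (-(1 / β)))
        ≤ D / S * (1 + residualRatio P β) := by
      gcongr
      exact mul_le_of_le_one_right hρ.le h2
    have h5 := (lt_div_iff₀ (show 0 < 1 + residualRatio P β by linarith)).1 hDS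
    linarith
  · have : 1 ≤ η / 2 * S := by
      rw [div_le_iff₀ hη] at hS2
      linarith
    linarith

/-- With depth at least four times the depth scale, `⌈4 S / n⌉` parallel queries push the noise
channel below half of the budget, because its exponent is at least `1 / 2`. -/
lemma eventually_exists_batched (P : ProblemConstants) {β : ℝ} (hβ : 2 ≤ β) :
    ∀ᶠ ε in 𝓝[>] (0 : ℝ), ∀ n : ℕ, 4 * depthScale P ε ≤ n → n ≤ coarseTime P β ε →
      ∃ b : ℕ, 1 < b ∧ (⟨n, b, 1⟩ : Design) ∈ feasible P β integerCounts ε ∧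
        (b : ℝ) * n ≤ 5 * coarseTime P β ε := by
  have hβ1 : 1 < β := by linarith
  have hp : 0 < 1 / β := one_div_pos.2 (by linarith)
  have hρ := residualRatio_pos P β
  have hsmall : ∀ᶠ ε in 𝓝[>] (0 : ℝ), coarseTime P β ε ^ (-(1 / β)) < (residualRatio P β)⁻¹ :=
    ((tendsto_rpow_neg_atTop hp).comp (tendsto_coarseTime P hβ1)).eventually
      (gt_mem_nhds (inv_pos.2 hρ))
  filter_upwards [self_mem_nhdsWithin, hsmall] with ε hε hσ n hn4 hnS
  have hε : 0 < ε := hε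
  have hS0 := coarseTime_pos P β hε
  have hD0 := depthScale_pos P hε
  set S := coarseTime P β ε
  set D := depthScale P ε
  have hn0 : (0 : ℝ) < n := by linarith
  have hb : 4 * S / n ≤ ⌈4 * S / n⌉₊ := Nat.le_ceil _
  have hb' := (Nat.ceil_lt_add_one (show 0 ≤ 4 * S / n by positivity)).le
  generalize ⌈4 * S / n⌉₊ = b at hb hb'
  have h4 : 4 ≤ 4 * S / n := by rw [le_div_iff₀ hn0]; linarith
  have hb4 : (4 : ℝ) ≤ b := h4.trans hb
  have hbn : 4 * S ≤ b * n := (div_le_iff₀ hn0).1 hb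
  have hbn' : (b : ℝ) * n ≤ 5 * S := by
    have : (b : ℝ) * n ≤ (4 * S / n + 1) * n := by gcongr
    rw [add_mul, div_mul_cancel₀ _ hn0.ne'] at this
    linarith
  have hb0 : (0 : ℝ) < b := by linarith
  have hb1 : 1 < b := by
    have : (1 : ℝ) < b := by linarith
    exact_mod_cast this
  refine ⟨b, hb1, ⟨⟨n, Nat.one_le_iff_ne_zero.2 (by rintro rfl; simp at hn0), rfl⟩,
    ⟨b, hb1.le, rfl⟩, one_pos, le_rfl, ?_⟩, hbn'⟩
  rw [errorBound_le_iff P hβ1 hε hn0 hb0 one_pos]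
  simp only [depthShare, noiseShare, effectiveWork_full_fidelity]
  have h1 : D / n ≤ 1 / 4 := by rw [div_le_iff₀ hn0]; linarith
  have h2 : residualRatio P β * ((b : ℝ) * n) ^ (-(1 / β)) ≤ 1 := by
    have : ((b : ℝ) * n) ^ (-(1 / β)) ≤ (residualRatio P β)⁻¹ :=
      (Real.rpow_le_rpow_of_nonpos hS0 (by linarith) (by linarith)).trans hσ.le
    calc _ ≤ residualRatio P β * (residualRatio P β)⁻¹ := by gcongr
      _ = 1 := mul_inv_cancel₀ hρ.ne'
  have h3 : (S / (b * n)) ^ ((β - 1) / β) ≤ 1 / 2 := by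
    calc _ ≤ (1 / 4 : ℝ) ^ ((β - 1) / β) := by
          refine Real.rpow_le_rpow (by positivity) ?_ (div_nonneg (by linarith) (by linarith))
          rw [div_le_iff₀ (by positivity)]
          linarith
      _ ≤ (1 / 4 : ℝ) ^ (1 / 2 : ℝ) := by
          refine Real.rpow_le_rpow_of_exponent_ge (by norm_num) (by norm_num) ?_
          rw [div_le_div_iff₀ (by norm_num) (by linarith)]
          linarith
      _ = 1 / 2 := by
          rw [← Real.sqrt_eq_rpow, show (1 / 4 : ℝ) = (1 / 2) ^ 2 by norm_num,
            Real.sqrt_sq (by norm_num)]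
  have h5 : D / n * (1 + residualRatio P β * ((b : ℝ) * n) ^ (-(1 / β))) ≤ 1 / 4 * (1 + 1) := by
    gcongr
  linarith

/-- The smallest admissible batched depth, `⌈4 D⌉`, is of the order of the depth scale and hence
negligible against the coarse time, which bounds every sequential depth from below. -/
lemma eventually_exists_shallow_batched (P : ProblemConstants) {β κ : ℝ} (hβ : 2 ≤ β)
    (hκ : 0 < κ) :
    ∀ᶠ ε in 𝓝[>] (0 : ℝ), ∃ n b : ℕ, 1 < b ∧ n ≤ 5 * depthScale P ε ∧
      (⟨n, b, 1⟩ : Design) ∈ feasible P β integerCounts ε ∧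
      (b : ℝ) * n ≤ 5 * coarseTime P β ε ∧ n ≤ κ * coarseTime P β ε := by
  have hβ1 : 1 < β := by linarith
  have hr := tendsto_depthScale_div_coarseTime P hβ1
  filter_upwards [self_mem_nhdsWithin, eventually_exists_batched P hβ,
    (tendsto_depthScale P).eventually_ge_atTop 1,
    hr.eventually (gt_mem_nhds (show 0 < κ / 5 by positivity)),
    hr.eventually (gt_mem_nhds (show (0 : ℝ) < 1 / 5 by norm_num))] with ε hε hbat hD1 hκD h5D
  have hS0 := coarseTime_pos P β (show 0 < ε from hε)
  rw [div_lt_iff₀ hS0] at hκD h5D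
  have hn : 4 * depthScale P ε ≤ ⌈4 * depthScale P ε⌉₊ := Nat.le_ceil _
  have hn' := (Nat.ceil_lt_add_one (show 0 ≤ 4 * depthScale P ε by linarith)).le
  generalize ⌈4 * depthScale P ε⌉₊ = n at hn hn'
  obtain ⟨b, hb, hf, hc⟩ := hbat n hn (by linarith)
  exact ⟨n, b, hb, by linarith, hf, hc, by linarith⟩

/-! ### Price exponent below two: the limiting problem -/

/-- Quantitative form of the weighted AM-GM inequality
`u ^ a * v ^ b ≤ U ^ a * V ^ b` for `u + v ≤ 1`, where `(U, V)` is proportional to `(a, b)`: the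
logarithmic defect controls the Hellinger distance to the maximizer. It follows from
`log t ≤ 2 (√t - 1)` at `t = u / U` and `t = v / V`. -/
lemma hellinger_le_log_div {a b u v : ℝ} (ha : 0 < a) (hb : 0 < b) (hu : 0 < u) (hv : 0 < v)
    (huv : u + v ≤ 1) :
    (a + b) * ((√u - √(a / (a + b))) ^ 2 + (√v - √(b / (a + b))) ^ 2) ≤
      Real.log (u ^ (-a) * v ^ (-b) / ((a / (a + b)) ^ (-a) * (b / (a + b)) ^ (-b))) := by
  have hab : 0 < a + b := by linarith
  have key : ∀ {w t : ℝ}, 0 < w → 0 < t →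
      w * (Real.log t - Real.log (w / (a + b))) ≤
        2 * (a + b) * (√t * √(w / (a + b)) - w / (a + b)) := by
    intro w t hw ht
    have hW : 0 < w / (a + b) := by positivity
    have h1 : Real.log (√t / √(w / (a + b))) ≤ √t / √(w / (a + b)) - 1 :=
      Real.log_le_sub_one_of_pos (by positivity)
    rw [Real.log_div (by positivity) (by positivity), Real.log_sqrt ht.le,
      Real.log_sqrt hW.le] at h1
    have h2 : √t * √(w / (a + b)) = √t / √(w / (a + b)) * (w / (a + b)) := by
      nth_rewrite 3 [← Real.mul_self_sqrt hW.le]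
      field_simp
    have h3 : w = (a + b) * (w / (a + b)) := by field_simp
    rw [h2]
    calc w * (Real.log t - Real.log (w / (a + b)))
        = 2 * w * (Real.log t / 2 - Real.log (w / (a + b)) / 2) := by ring
      _ ≤ 2 * w * (√t / √(w / (a + b)) - 1) := by gcongr
      _ = _ := by nth_rewrite 1 [h3]; ring
  have h1 := key ha hu
  have h2 := key hb hv
  have hU : 0 < a / (a + b) := by positivity
  have hV : 0 < b / (a + b) := by positivity
  rw [Real.log_div (by positivity) (by positivity), Real.log_mul (by positivity) (by positivity),
    Real.log_mul (by positivity) (by positivity), Real.log_rpow hu, Real.log_rpow hv,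
    Real.log_rpow hU, Real.log_rpow hV]
  have hsum : a / (a + b) + b / (a + b) = 1 := by field_simp
  have e1 := Real.sq_sqrt hu.le
  have e2 := Real.sq_sqrt hv.le
  have e3 := Real.sq_sqrt hU.le
  have e4 := Real.sq_sqrt hV.le
  have h5 : (a + b) * ((√u - √(a / (a + b))) ^ 2 + (√v - √(b / (a + b))) ^ 2) ≤
      (a + b) * (2 - 2 * (√u * √(a / (a + b))) - 2 * (√v * √(b / (a + b)))) := by
    refine mul_le_mul_of_nonneg_left ?_ hab.le
    nlinarith
  have h6 : (a + b) * (a / (a + b)) + (a + b) * (b / (a + b)) = a + b := by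
    rw [← mul_add, hsum, mul_one]
  linarith

/-- Exponent of the deterministic share in the cost of a sequential design. -/
def depthExponent (γ : ℝ) : ℝ := 1 - γ / 2

/-- Exponent of the noise share in the cost of a sequential design. -/
def noiseExponent (β γ : ℝ) : ℝ := γ * β / (2 * (β - 1))

/-- Optimal deterministic share in the limit `ε → 0`. -/
def limitDepthShare (β γ : ℝ) : ℝ := depthExponent γ / (depthExponent γ + noiseExponent β γ)

/-- Optimal noise share in the limit `ε → 0`. -/
def limitNoiseShare (β γ : ℝ) : ℝ := noiseExponent β γ / (depthExponent γ + noiseExponent β γ)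

/-- Cost of a sequential design relative to `timeScale`, as a function of the two shares. -/
def relativeCost (β γ u v : ℝ) : ℝ := u ^ (-depthExponent γ) * v ^ (-noiseExponent β γ)

lemma depthExponent_pos {γ : ℝ} (hγ2 : γ < 2) : 0 < depthExponent γ := by
  unfold depthExponent; linarith

lemma noiseExponent_pos {β γ : ℝ} (hβ : 1 < β) (hγ : 0 < γ) : 0 < noiseExponent β γ :=
  div_pos (mul_pos hγ (by linarith)) (by linarith)

section Limits
variable {β γ : ℝ}

lemma limitDepthShare_pos (hβ : 1 < β) (hγ : 0 < γ) (hγ2 : γ < 2) : 0 < limitDepthShare β γ := by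
  have := depthExponent_pos hγ2; have := noiseExponent_pos hβ hγ
  unfold limitDepthShare; positivity

lemma limitNoiseShare_pos (hβ : 1 < β) (hγ : 0 < γ) (hγ2 : γ < 2) : 0 < limitNoiseShare β γ := by
  have := depthExponent_pos hγ2; have := noiseExponent_pos hβ hγ
  unfold limitNoiseShare; positivity

lemma limitDepthShare_add_limitNoiseShare (hβ : 1 < β) (hγ : 0 < γ) (hγ2 : γ < 2) :
    limitDepthShare β γ + limitNoiseShare β γ = 1 := by
  have := depthExponent_pos hγ2; have := noiseExponent_pos hβ hγ
  unfold limitDepthShare limitNoiseShare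
  field_simp

lemma relativeCost_pos {u v : ℝ} (hu : 0 < u) (hv : 0 < v) : 0 < relativeCost β γ u v := by
  unfold relativeCost; positivity

lemma depthExponent_add_noiseExponent (hβ : 1 < β) :
    depthExponent γ + noiseExponent β γ = (2 * β - 2 + γ) / (2 * (β - 1)) := by
  have : β - 1 ≠ 0 := by linarith
  unfold depthExponent noiseExponent
  field_simp
  ring

lemma depthFactor_eq (hβ : 1 < β) (hγ2 : γ < 2) :
    depthFactor β γ = (limitDepthShare β γ)⁻¹ := by
  have : β - 1 ≠ 0 := by linarith
  have : 2 - γ ≠ 0 := by linarith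
  unfold limitDepthShare depthFactor
  rw [depthExponent_add_noiseExponent hβ, depthExponent,
    show 1 - γ / 2 = (2 - γ) / 2 by ring, inv_div]
  field_simp

lemma limitNoiseShare_eq (hβ : 1 < β) : limitNoiseShare β γ = γ * β / (2 * β - 2 + γ) := by
  have : β - 1 ≠ 0 := by linarith
  unfold limitNoiseShare
  rw [depthExponent_add_noiseExponent hβ, noiseExponent]
  field_simp

lemma fidelityFactor_eq (hβ : 1 < β) (hγ : 0 < γ) (hγ2 : γ < 2) :
    fidelityFactor β γ =
      (limitNoiseShare β γ ^ (β / (β - 1)) / limitDepthShare β γ) ^ ((1 : ℝ) / 2) := by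
  have hU := limitDepthShare_pos hβ hγ hγ2
  have hV := limitNoiseShare_pos hβ hγ hγ2
  have hβ1 : β - 1 ≠ 0 := by linarith
  unfold fidelityFactor
  rw [depthFactor_eq hβ hγ2, ← limitNoiseShare_eq hβ, div_eq_mul_inv _ (limitDepthShare β γ),
    Real.mul_rpow (by positivity) (by positivity), ← Real.rpow_mul hV.le]
  congr 2
  field_simp

lemma relativeCost_limit (hβ : 1 < β) (hγ : 0 < γ) (hγ2 : γ < 2) :
    relativeCost β γ (limitDepthShare β γ) (limitNoiseShare β γ) =
      depthFactor β γ * fidelityFactor β γ ^ (-γ) := by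
  rw [fidelityFactor_eq hβ hγ hγ2, depthFactor_eq hβ hγ2]
  have hU := limitDepthShare_pos hβ hγ hγ2
  have hV := limitNoiseShare_pos hβ hγ hγ2
  have hβ1 : β - 1 ≠ 0 := by linarith
  unfold relativeCost depthExponent noiseExponent
  obtain ⟨u, hu⟩ : ∃ t, limitDepthShare β γ = Real.exp t := ⟨_, (Real.exp_log hU).symm⟩
  obtain ⟨v, hv⟩ : ∃ t, limitNoiseShare β γ = Real.exp t := ⟨_, (Real.exp_log hV).symm⟩
  rw [hu, hv]
  simp only [← Real.exp_mul, ← Real.exp_add, ← Real.exp_sub, ← Real.exp_neg]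
  congr 1; field_simp; ring

end Limits

/-! ### Price exponent below two: sequential designs in terms of the two shares -/

/-- Trading batch size against fidelity at constant error: `(N, B, δ)` and `(N, 1, δ / √B)` have
the same error bound, and the second is cheaper if `B > 1`. -/
lemma IsOptimal.sequential {P : ProblemConstants} {β γ ε : ℝ} (hβ : 1 < β) (hγ2 : γ < 2)
    (hε : 0 < ε) {S : Set ℝ} (hS : S = integerCounts ∨ S = continuousCounts) {x : Design}
    (hx : IsOptimal P β γ S ε x) : x.B = 1 := by
  obtain ⟨⟨hN, hB, hδ, hδ1, hE⟩, hmin⟩ := hx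
  have hN0 := one_pos.trans_le (one_le_of_mem_counts hS hN)
  have hB1 := one_le_of_mem_counts hS hB
  have hB0 : 0 < x.B := by linarith
  by_contra hne
  have hB1' : 1 < x.B := lt_of_le_of_ne hB1 (Ne.symm hne)
  have hsB : 1 ≤ √x.B := Real.one_le_sqrt.2 hB1
  have hδ' : 0 < x.δ / √x.B := by positivity
  have hM : effectiveWork ⟨x.N, 1, x.δ / √x.B⟩ = effectiveWork x := by
    simp only [effectiveWork, div_pow, Real.sq_sqrt hB0.le]
    field_simp
  have hf : (⟨x.N, 1, x.δ / √x.B⟩ : Design) ∈ feasible P β S ε := by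
    refine ⟨hN, one_mem_counts hS, hδ', (div_le_self hδ.le hsB).trans hδ1, ?_⟩
    rw [errorBound_le_iff P hβ hε hN0 hB0 hδ] at hE
    refine (errorBound_le_iff P hβ hε (x := ⟨x.N, 1, x.δ / √x.B⟩) hN0 one_pos hδ').2 ?_
    simp only [noiseShare, hM] at hE ⊢
    exact hE
  have hcost := hmin _ hf
  unfold wallClock at hcost
  dsimp only at hcost
  have hsplit : (x.δ / √x.B) ^ (-γ) = x.δ ^ (-γ) * x.B ^ (γ / 2) := by
    rw [Real.div_rpow hδ.le (by positivity), Real.sqrt_eq_rpow, ← Real.rpow_mul hB0.le,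
      div_eq_mul_inv, ← Real.rpow_neg hB0.le]
    congr 2; ring
  have hlt : x.B ^ (γ / 2) < x.B := by
    nth_rewrite 2 [← Real.rpow_one x.B]
    exact Real.rpow_lt_rpow_of_exponent_lt hB1' (by linarith)
  have hpos : 0 < x.N * x.δ ^ (-γ) := by positivity
  rw [hsplit] at hcost
  have := mul_lt_mul_of_pos_left hlt hpos
  linarith

lemma wallClock_eq_timeScale_mul (P : ProblemConstants) {β ε : ℝ} (γ : ℝ) (hβ : 1 < β)
    (hε : 0 < ε) {x : Design} (hN : 0 < x.N) (hB : x.B = 1) (hδ : 0 < x.δ) :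
    wallClock γ x =
      timeScale P β γ ε * relativeCost β γ (depthShare P ε x) (noiseShare P β ε x) := by
  obtain ⟨N, B, δ⟩ := x
  dsimp only at *
  subst hB
  rw [timeScale_eq P γ hβ hε]
  unfold wallClock relativeCost depthShare noiseShare effectiveWork depthExponent noiseExponent
  have hD := depthScale_pos P hε
  have hS := coarseTime_pos P β hε
  generalize depthScale P ε = D at *
  generalize coarseTime P β ε = S at *
  have hβ1 : β - 1 ≠ 0 := by linarith
  have hβ0 : β ≠ 0 := by linarith
  obtain ⟨N, rfl⟩ : ∃ t, N = Real.exp t := ⟨_, (Real.exp_log hN).symm⟩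
  obtain ⟨δ, rfl⟩ : ∃ t, δ = Real.exp t := ⟨_, (Real.exp_log hδ).symm⟩
  obtain ⟨D, rfl⟩ : ∃ t, D = Real.exp t := ⟨_, (Real.exp_log hD).symm⟩
  obtain ⟨S, rfl⟩ : ∃ t, S = Real.exp t := ⟨_, (Real.exp_log hS).symm⟩
  simp only [← Real.rpow_natCast, ← Real.exp_mul, ← Real.exp_add, ← Real.exp_sub, one_mul]
  congr 1; push_cast; field_simp; ring

lemma fidelity_eq (P : ProblemConstants) {β ε : ℝ} (hβ : 1 < β)
    (hε : 0 < ε) {x : Design} (hN : 0 < x.N) (hB : x.B = 1) (hδ : 0 < x.δ) :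
    x.δ = (depthScale P ε / coarseTime P β ε) ^ ((1 : ℝ) / 2) *
      (noiseShare P β ε x ^ (β / (β - 1)) / depthShare P ε x) ^ ((1 : ℝ) / 2) := by
  obtain ⟨N, B, δ⟩ := x
  dsimp only at *
  subst hB
  unfold depthShare noiseShare effectiveWork
  have hD := depthScale_pos P hε
  have hS := coarseTime_pos P β hε
  generalize depthScale P ε = D at *
  generalize coarseTime P β ε = S at *
  have hβ1 : β - 1 ≠ 0 := by linarith
  have hβ0 : β ≠ 0 := by linarith
  obtain ⟨N, rfl⟩ : ∃ t, N = Real.exp t := ⟨_, (Real.exp_log hN).symm⟩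
  obtain ⟨δ, rfl⟩ : ∃ t, δ = Real.exp t := ⟨_, (Real.exp_log hδ).symm⟩
  obtain ⟨D, rfl⟩ : ∃ t, D = Real.exp t := ⟨_, (Real.exp_log hD).symm⟩
  obtain ⟨S, rfl⟩ : ∃ t, S = Real.exp t := ⟨_, (Real.exp_log hS).symm⟩
  simp only [← Real.rpow_natCast, ← Real.exp_mul, ← Real.exp_add, ← Real.exp_sub, one_mul]
  congr 1; push_cast; field_simp; ring

/-- Integer designs come arbitrarily close to the limiting optimal cost: take the depth
`⌈D / U⌉`, with `D` the depth scale and `U` the limiting deterministic share, and choose the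
fidelity so that the noise share falls short of its limit by a fixed factor `θ < 1`. The slack
absorbs the residual channel. -/
lemma eventually_exists_wallClock_le (P : ProblemConstants) {β γ K : ℝ} (hβ : 1 < β)
    (hγ : 0 < γ) (hγ2 : γ < 2)
    (hK : relativeCost β γ (limitDepthShare β γ) (limitNoiseShare β γ) < K) {S : Set ℝ}
    (hS : S = integerCounts ∨ S = continuousCounts) :
    ∀ᶠ ε in 𝓝[>] (0 : ℝ), ∃ y ∈ feasible P β S ε, wallClock γ y ≤ timeScale P β γ ε * K := by
  have hU := limitDepthShare_pos hβ hγ hγ2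
  have hV := limitNoiseShare_pos hβ hγ hγ2
  have hUV := limitDepthShare_add_limitNoiseShare hβ hγ hγ2
  set U := limitDepthShare β γ
  set V := limitNoiseShare β γ
  have hβ1 : β - 1 ≠ 0 := by linarith
  have hp : 0 < 1 / β := one_div_pos.2 (by linarith)
  obtain ⟨θ, hθK, hθ0, hθ1⟩ : ∃ θ, relativeCost β γ U (θ * V) < K ∧ 0 < θ ∧ θ < 1 := by
    have hc : ContinuousAt (fun θ => relativeCost β γ U (θ * V)) 1 := by
      unfold relativeCost
      exact continuousAt_const.mul
        (ContinuousAt.rpow_const (by fun_prop) (Or.inl (by positivity)))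
    have h1 : ∀ᶠ θ in 𝓝[<] (1 : ℝ), relativeCost β γ U (θ * V) < K :=
      (hc.eventually (gt_mem_nhds (by simpa using hK))).filter_mono nhdsWithin_le_nhds
    have h2 : ∀ᶠ θ in 𝓝[<] (1 : ℝ), 0 < θ :=
      (lt_mem_nhds one_pos).filter_mono nhdsWithin_le_nhds
    have h3 : ∀ᶠ θ in 𝓝[<] (1 : ℝ), θ < 1 := self_mem_nhdsWithin
    obtain ⟨θ, ⟨a, b⟩, c⟩ := ((h1.and h2).and h3).exists
    exact ⟨θ, a, b, c⟩
  have hθV : 0 < θ * V := by positivity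
  -- `c` is the ratio of the coarse time to the effective work of the competitor.
  obtain ⟨c, hc0, hcq⟩ : ∃ c : ℝ, 0 < c ∧ c ^ ((β - 1) / β) = θ * V :=
    ⟨(θ * V) ^ (β / (β - 1)), by positivity, by
      rw [← Real.rpow_mul hθV.le, show β / (β - 1) * ((β - 1) / β) = 1 by
        have : β ≠ 0 := by linarith
        field_simp, Real.rpow_one]⟩
  have hceil : Tendsto (fun ε => (⌈U⁻¹ * depthScale P ε⌉₊ : ℝ) / depthScale P ε) (𝓝[>] 0)
      (𝓝 U⁻¹) :=
    (tendsto_nat_ceil_mul_div_atTop (R := ℝ) (inv_nonneg.2 hU.le)).comp (tendsto_depthScale P)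
  have hcost : ∀ᶠ ε in 𝓝[>] (0 : ℝ), relativeCost β γ
      (depthScale P ε / (⌈U⁻¹ * depthScale P ε⌉₊ : ℝ)) (θ * V) < K := by
    have h1 : Tendsto (fun ε => depthScale P ε / (⌈U⁻¹ * depthScale P ε⌉₊ : ℝ)) (𝓝[>] 0)
        (𝓝 U) := by
      simpa using hceil.inv₀ (inv_ne_zero hU.ne')
    have h2 : ContinuousAt (fun u => relativeCost β γ u (θ * V)) U := by
      unfold relativeCost
      exact (continuousAt_id.rpow_const (Or.inl hU.ne')).mul continuousAt_const
    exact (h2.tendsto.comp h1).eventually (gt_mem_nhds hθK)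
  have hfid : ∀ᶠ ε in 𝓝[>] (0 : ℝ), (⌈U⁻¹ * depthScale P ε⌉₊ : ℝ) / depthScale P ε *
      (depthScale P ε / coarseTime P β ε) * c < 1 :=
    ((hceil.mul (tendsto_depthScale_div_coarseTime P hβ)).mul_const c).eventually
      (gt_mem_nhds (by simp))
  have hres : ∀ᶠ ε in 𝓝[>] (0 : ℝ),
      U * (residualRatio P β * (coarseTime P β ε / c) ^ (-(1 / β))) < (1 - θ) * V := by
    have h1 := (tendsto_rpow_neg_atTop hp).comp ((tendsto_coarseTime P hβ).atTop_div_const hc0)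
    have h2 := (h1.const_mul (residualRatio P β)).const_mul U
    refine h2.eventually (gt_mem_nhds ?_)
    rw [mul_zero, mul_zero]
    exact mul_pos (by linarith) hV
  filter_upwards [self_mem_nhdsWithin, hcost, hfid, hres] with ε hε hcost hfid hres
  have hε : 0 < ε := hε
  have hD0 := depthScale_pos P hε
  have hS0 := coarseTime_pos P β hε
  have hn : U⁻¹ * depthScale P ε ≤ ⌈U⁻¹ * depthScale P ε⌉₊ := Nat.le_ceil _
  generalize ⌈U⁻¹ * depthScale P ε⌉₊ = n at hcost hfid hn
  have hn0 : (0 : ℝ) < n := lt_of_lt_of_le (by positivity) hn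
  have hn1 : 1 ≤ n := by
    have : 0 < n := by exact_mod_cast hn0
    exact this
  have hδ0 : 0 < √(n * c / coarseTime P β ε) := by positivity
  have hM : effectiveWork ⟨n, 1, √(n * c / coarseTime P β ε)⟩ = coarseTime P β ε / c := by
    simp only [effectiveWork, one_mul]
    rw [Real.sq_sqrt (by positivity)]
    field_simp
  have hv : noiseShare P β ε ⟨n, 1, √(n * c / coarseTime P β ε)⟩ = θ * V := by
    rw [noiseShare, hM, ← hcq]
    congr 1
    field_simp
  refine ⟨⟨n, 1, √(n * c / coarseTime P β ε)⟩,
    ⟨natCast_mem_counts hS hn1, one_mem_counts hS, hδ0, ?_, ?_⟩, ?_⟩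
  · rw [Real.sqrt_le_iff, one_pow]
    refine ⟨one_pos.le, ?_⟩
    refine le_trans (le_of_eq ?_) hfid.le
    field_simp
  · rw [errorBound_le_iff P hβ hε hn0 one_pos hδ0, hM, hv]
    simp only [depthShare]
    have hu : depthScale P ε / n ≤ U := by
      rw [div_le_iff₀ hn0]
      rwa [inv_mul_le_iff₀ hU] at hn
    have hρ := residualRatio_pos P β
    have : depthScale P ε / n *
        (1 + residualRatio P β * (coarseTime P β ε / c) ^ (-(1 / β))) ≤
        U * (1 + residualRatio P β * (coarseTime P β ε / c) ^ (-(1 / β))) := by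
      gcongr
    linarith
  · rw [wallClock_eq_timeScale_mul P γ hβ hε hn0 rfl hδ0, hv]
    exact mul_le_mul_of_nonneg_left hcost.le (timeScale_pos P β γ hε).le

/-! ### Price exponent below two: asymptotics of the optima -/

/-- The filter on pairs `(ε, x)` generated by `ε → 0+` with `x` optimal at level `ε`. Convergence
along it is convergence uniformly over all optimal designs. -/
def optimaFilter (P : ProblemConstants) (β γ : ℝ) (S : Set ℝ) : Filter (ℝ × Design) :=
  comap Prod.fst (𝓝[>] 0) ⊓ 𝓟 {p | IsOptimal P β γ S p.1 p.2}

lemma eventually_optimaFilter {P : ProblemConstants} {β γ : ℝ} {S : Set ℝ}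
    {Q : ℝ → Design → Prop} :
    (∀ᶠ p in optimaFilter P β γ S, Q p.1 p.2) ↔
      ∀ᶠ ε in 𝓝[>] (0 : ℝ), ∀ x, IsOptimal P β γ S ε x → Q ε x := by
  rw [optimaFilter, eventually_inf_principal, eventually_comap]
  constructor
  · intro h
    filter_upwards [h] with ε hε x hx
    exact hε (ε, x) rfl hx
  · intro h
    filter_upwards [h] with ε hε p hp hx
    subst hp
    exact hε p.2 hx

section Asymptotics
variable {P : ProblemConstants} {β γ : ℝ} {S : Set ℝ}

/-- Basic facts about an optimal design for a price exponent below `2`. -/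
lemma eventually_optimal_facts (hβ : 1 < β) (hγ2 : γ < 2)
    (hS : S = integerCounts ∨ S = continuousCounts) :
    ∀ᶠ p in optimaFilter P β γ S, 0 < p.1 ∧ 0 < p.2.N ∧ p.2.B = 1 ∧ 0 < p.2.δ ∧
      0 < depthShare P p.1 p.2 ∧ 0 < noiseShare P β p.1 p.2 ∧
      depthShare P p.1 p.2 + noiseShare P β p.1 p.2 ≤ 1 := by
  rw [eventually_optimaFilter (Q := fun ε x => 0 < ε ∧ 0 < x.N ∧ x.B = 1 ∧ 0 < x.δ ∧
    0 < depthShare P ε x ∧ 0 < noiseShare P β ε x ∧ depthShare P ε x + noiseShare P β ε x ≤ 1)]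
  filter_upwards [self_mem_nhdsWithin] with ε hε x hx
  have hε : 0 < ε := hε
  have hN : 0 < x.N := one_pos.trans_le (one_le_of_mem_counts hS hx.1.1)
  have hB : x.B = 1 := hx.sequential hβ hγ2 hε hS
  have hB0 : 0 < x.B := by rw [hB]; exact one_pos
  have hδ : 0 < x.δ := hx.1.2.2.1
  exact ⟨hε, hN, hB, hδ, depthShare_pos P hε hN, noiseShare_pos P β hε hN hB0 hδ,
    depthShare_add_noiseShare_le_one hβ hε hN hB0 hδ hx.1.2.2.2.2⟩

/-- The relative cost of the optima tends to the limiting optimum: the lower bound is the weighted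
AM-GM inequality, the upper bound comes from explicit integer designs. -/
lemma tendsto_relativeCost (hβ : 1 < β) (hγ : 0 < γ) (hγ2 : γ < 2)
    (hS : S = integerCounts ∨ S = continuousCounts) :
    Tendsto (fun p : ℝ × Design => relativeCost β γ (depthShare P p.1 p.2)
      (noiseShare P β p.1 p.2)) (optimaFilter P β γ S)
      (𝓝 (relativeCost β γ (limitDepthShare β γ) (limitNoiseShare β γ))) := by
  have ha := depthExponent_pos hγ2
  have hb := noiseExponent_pos hβ hγ
  refine tendsto_order.2 ⟨fun K hK => ?_, fun K hK => ?_⟩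
  · filter_upwards [eventually_optimal_facts hβ hγ2 hS] with p hp
    obtain ⟨-, -, -, -, hu, hv, huv⟩ := hp
    refine hK.trans_le ?_
    have hlog : 0 ≤ Real.log (relativeCost β γ (depthShare P p.1 p.2) (noiseShare P β p.1 p.2) /
        relativeCost β γ (limitDepthShare β γ) (limitNoiseShare β γ)) :=
      le_trans (by positivity) (hellinger_le_log_div ha hb hu hv huv)
    have hF := relativeCost_pos (β := β) (γ := γ) hu hv
    have hF' := relativeCost_pos (β := β) (γ := γ) (limitDepthShare_pos hβ hγ hγ2)
      (limitNoiseShare_pos hβ hγ hγ2)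
    rwa [Real.log_nonneg_iff (by positivity), one_le_div hF'] at hlog
  · obtain ⟨K', hK', hK'K⟩ := exists_between hK
    have hle : ∀ᶠ p in optimaFilter P β γ S, wallClock γ p.2 ≤ timeScale P β γ p.1 * K' := by
      rw [eventually_optimaFilter (Q := fun ε x => wallClock γ x ≤ timeScale P β γ ε * K')]
      filter_upwards [eventually_exists_wallClock_le P hβ hγ hγ2 hK' hS] with ε hε x hx
      obtain ⟨y, hy, hyK⟩ := hε
      exact (hx.2 y hy).trans hyK
    filter_upwards [eventually_optimal_facts hβ hγ2 hS, hle] with p hp hle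
    obtain ⟨hε, hN, hB, hδ, -, -, -⟩ := hp
    rw [wallClock_eq_timeScale_mul P γ hβ hε hN hB hδ] at hle
    exact (le_of_mul_le_mul_left hle (timeScale_pos P β γ hε)).trans_lt hK'K

/-- Near-optimal cost forces both shares to their limits, by the Hellinger bound. -/
lemma tendsto_shares (hβ : 1 < β) (hγ : 0 < γ) (hγ2 : γ < 2)
    (hS : S = integerCounts ∨ S = continuousCounts) :
    Tendsto (fun p : ℝ × Design => depthShare P p.1 p.2) (optimaFilter P β γ S)
      (𝓝 (limitDepthShare β γ)) ∧
    Tendsto (fun p : ℝ × Design => noiseShare P β p.1 p.2) (optimaFilter P β γ S)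
      (𝓝 (limitNoiseShare β γ)) := by
  have ha := depthExponent_pos hγ2
  have hb := noiseExponent_pos hβ hγ
  have hab : 0 < depthExponent γ + noiseExponent β γ := by linarith
  have hU := limitDepthShare_pos hβ hγ hγ2
  have hV := limitNoiseShare_pos hβ hγ hγ2
  have hF := relativeCost_pos (β := β) (γ := γ) hU hV
  have hlog : Tendsto (fun p : ℝ × Design => Real.log (relativeCost β γ (depthShare P p.1 p.2)
      (noiseShare P β p.1 p.2) / relativeCost β γ (limitDepthShare β γ) (limitNoiseShare β γ)) /
      (depthExponent γ + noiseExponent β γ)) (optimaFilter P β γ S) (𝓝 0) := by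
    have h := ((tendsto_relativeCost (P := P) hβ hγ hγ2 hS).div_const
      (relativeCost β γ (limitDepthShare β γ) (limitNoiseShare β γ)))
    rw [div_self hF.ne'] at h
    simpa using (h.log one_ne_zero).div_const (depthExponent γ + noiseExponent β γ)
  have hbound : ∀ᶠ p in optimaFilter P β γ S,
      (√(depthShare P p.1 p.2) - √(limitDepthShare β γ)) ^ 2 +
        (√(noiseShare P β p.1 p.2) - √(limitNoiseShare β γ)) ^ 2 ≤
      Real.log (relativeCost β γ (depthShare P p.1 p.2)
        (noiseShare P β p.1 p.2) / relativeCost β γ (limitDepthShare β γ) (limitNoiseShare β γ)) /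
        (depthExponent γ + noiseExponent β γ) := by
    filter_upwards [eventually_optimal_facts hβ hγ2 hS] with p hp
    obtain ⟨-, -, -, -, hu, hv, huv⟩ := hp
    rw [le_div_iff₀' hab]
    exact hellinger_le_log_div ha hb hu hv huv
  have hpass : ∀ {f : ℝ × Design → ℝ} {w : ℝ}, 0 < w → (∀ᶠ p in optimaFilter P β γ S, 0 < f p) →
      Tendsto (fun p => (√(f p) - √w) ^ 2) (optimaFilter P β γ S) (𝓝 0) →
      Tendsto f (optimaFilter P β γ S) (𝓝 w) := by
    intro f w hw hf h
    have h1 := h.sqrt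
    simp only [Real.sqrt_sq_eq_abs, Real.sqrt_zero] at h1
    have h2 := ((tendsto_zero_iff_abs_tendsto_zero _).2 h1).add_const √w
    simp only [sub_add_cancel, zero_add] at h2
    have h3 := h2.pow 2
    rw [Real.sq_sqrt hw.le] at h3
    refine h3.congr' ?_
    filter_upwards [hf] with p hp
    exact Real.sq_sqrt hp.le
  have hfacts := eventually_optimal_facts (P := P) hβ hγ2 hS
  constructor
  · refine hpass hU (hfacts.mono fun p hp => hp.2.2.2.2.1) ?_
    refine squeeze_zero' (Eventually.of_forall fun p => sq_nonneg _) ?_ hlog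
    filter_upwards [hbound] with p hp
    exact (le_add_of_nonneg_right (sq_nonneg _)).trans hp
  · refine hpass hV (hfacts.mono fun p hp => hp.2.2.2.2.2.1) ?_
    refine squeeze_zero' (Eventually.of_forall fun p => sq_nonneg _) ?_ hlog
    filter_upwards [hbound] with p hp
    exact (le_add_of_nonneg_left (sq_nonneg _)).trans hp

lemma tendsto_depth_div_leadN (hβ : 1 < β) (hγ : 0 < γ) (hγ2 : γ < 2)
    (hS : S = integerCounts ∨ S = continuousCounts) :
    Tendsto (fun p : ℝ × Design => p.2.N / leadN P β γ p.1) (optimaFilter P β γ S) (𝓝 1) := by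
  have hU := limitDepthShare_pos hβ hγ hγ2
  have h := ((tendsto_shares (P := P) hβ hγ hγ2 hS).1.inv₀ hU.ne').const_mul
    (limitDepthShare β γ)
  rw [mul_inv_cancel₀ hU.ne'] at h
  refine h.congr' ?_
  filter_upwards [eventually_optimal_facts hβ hγ2 hS] with p hp
  have hD := depthScale_pos P hp.1
  have hN := hp.2.1
  rw [leadN, depthFactor_eq hβ hγ2, depthShare]
  field_simp

lemma tendsto_fidelity_div_leadδ (hβ : 1 < β) (hγ : 0 < γ) (hγ2 : γ < 2)
    (hS : S = integerCounts ∨ S = continuousCounts) :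
    Tendsto (fun p : ℝ × Design => p.2.δ / leadδ P β γ p.1) (optimaFilter P β γ S) (𝓝 1) := by
  have hU := limitDepthShare_pos hβ hγ hγ2
  have hV := limitNoiseShare_pos hβ hγ hγ2
  obtain ⟨hu, hv⟩ := tendsto_shares (P := P) hβ hγ hγ2 hS
  have hC : 0 < fidelityFactor β γ := by
    rw [fidelityFactor_eq hβ hγ hγ2]; positivity
  have h := (((hv.rpow_const (p := β / (β - 1)) (Or.inl hV.ne')).div hu hU.ne').rpow_const
    (p := (1 : ℝ) / 2) (Or.inl (by positivity))).div_const (fidelityFactor β γ)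
  rw [← fidelityFactor_eq hβ hγ hγ2, div_self hC.ne'] at h
  refine h.congr' ?_
  filter_upwards [eventually_optimal_facts hβ hγ2 hS] with p hp
  obtain ⟨hε, hN, hB, hδ, -, -, -⟩ := hp
  have hD := depthScale_pos P hε
  have hT := coarseTime_pos P β hε
  rw [fidelity_eq P hβ hε hN hB hδ, leadδ_eq P γ hβ hε, mul_div_mul_left _ _ (by positivity)]
  rfl

lemma tendsto_wallClock_div (hβ : 1 < β) (hγ : 0 < γ) (hγ2 : γ < 2)
    (hS : S = integerCounts ∨ S = continuousCounts) :
    Tendsto (fun p : ℝ × Design => wallClock γ p.2 /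
      (timeScale P β γ p.1 * (depthFactor β γ * fidelityFactor β γ ^ (-γ))))
      (optimaFilter P β γ S) (𝓝 1) := by
  have hF := relativeCost_pos (β := β) (γ := γ) (limitDepthShare_pos hβ hγ hγ2)
    (limitNoiseShare_pos hβ hγ hγ2)
  have h := ((tendsto_relativeCost (P := P) hβ hγ hγ2 hS).div_const
    (relativeCost β γ (limitDepthShare β γ) (limitNoiseShare β γ)))
  rw [div_self hF.ne'] at h
  refine h.congr' ?_
  filter_upwards [eventually_optimal_facts hβ hγ2 hS] with p hp
  obtain ⟨hε, hN, hB, hδ, -, -, -⟩ := hp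
  rw [wallClock_eq_timeScale_mul P γ hβ hε hN hB hδ, ← relativeCost_limit hβ hγ hγ2,
    mul_div_mul_left _ _ (timeScale_pos P β γ hε).ne']

end Asymptotics

lemma abs_sub_one_le_of_tendsto {α : Type*} {l : Filter α} {f : α → ℝ} (h : Tendsto f l (𝓝 1))
    {η : ℝ} (hη : 0 < η) : ∀ᶠ a in l, |f a - 1| ≤ η := by
  filter_upwards [h.eventually (Metric.closedBall_mem_nhds 1 hη)] with a ha
  rwa [← Real.dist_eq]

end

theorem mainTheorem7 (β γ : ℝ) (hβ : 2 ≤ β) (hγ : 0 < γ) :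
    -- the case `0 < γ < 2`
    (γ < 2 →
      (∀ P : ProblemConstants, ∀ S : Set ℝ, (S = integerCounts ∨ S = continuousCounts) →
        (∀ ε : ℝ, 0 < ε →
          (∃ x, IsOptimal P β γ S ε x) ∧ ∀ x, IsOptimal P β γ S ε x → x.B = 1) ∧
        (∀ η : ℝ, 0 < η → ∀ᶠ ε in 𝓝[>] (0 : ℝ), ∀ x, IsOptimal P β γ S ε x →
          |x.N / leadN P β γ ε - 1| ≤ η ∧
          |x.δ / leadδ P β γ ε - 1| ≤ η ∧
          |wallClock γ x /
            (timeScale P β γ ε * (depthFactor β γ * fidelityFactor β γ ^ (-γ))) - 1| ≤ η)) ∧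
      (∃ c C : ℝ, 0 < c ∧ 0 < C ∧
        ∀ P : ProblemConstants, ∀ S : Set ℝ, (S = integerCounts ∨ S = continuousCounts) →
          ∀ᶠ ε in 𝓝[>] (0 : ℝ), ∀ x, IsOptimal P β γ S ε x →
            c * (timeScale P β γ ε * fidelityFactor β γ) ≤ wallClock γ x ∧
            wallClock γ x ≤ C * (timeScale P β γ ε * fidelityFactor β γ))) ∧
    -- the case `γ ≥ 2`
    (2 ≤ γ → ∀ P : ProblemConstants,
      -- the optimum is at the boundary `δ = 1`
      (∀ ε : ℝ, 0 < ε →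
        (∃ x, IsOptimal P β γ continuousCounts ε x) ∧
        ∀ x, IsOptimal P β γ continuousCounts ε x → x.δ = 1 ∧ x.B = 1) ∧
      -- optimal wall-clock time, for integer designs and for the continuous relaxation
      (∀ S : Set ℝ, (S = integerCounts ∨ S = continuousCounts) →
        (∀ ε : ℝ, 0 < ε → ∃ x, IsOptimal P β γ S ε x) ∧
        (∀ η : ℝ, 0 < η → ∀ᶠ ε in 𝓝[>] (0 : ℝ), ∀ x, IsOptimal P β γ S ε x →
          |wallClock γ x / coarseTime P β ε - 1| ≤ η)) ∧
      -- sequential integer designs with `δ = 1`, `B = 1` attain it to leading order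
      (∀ η : ℝ, 0 < η → ∀ᶠ ε in 𝓝[>] (0 : ℝ), ∃ n : ℕ,
        (⟨n, 1, 1⟩ : Design) ∈ feasible P β integerCounts ε ∧
        ∀ y ∈ feasible P β continuousCounts ε, wallClock γ ⟨n, 1, 1⟩ ≤ (1 + η) * wallClock γ y) ∧
      -- batched designs with `δ = 1` attain the same order, for every smaller depth in this range
      (∀ᶠ ε in 𝓝[>] (0 : ℝ), ∀ n : ℕ, 4 * depthScale P ε ≤ n → n ≤ coarseTime P β ε →
        ∃ b : ℕ, 1 < b ∧ (⟨n, b, 1⟩ : Design) ∈ feasible P β integerCounts ε ∧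
          ∀ y ∈ feasible P β continuousCounts ε, wallClock γ ⟨n, b, 1⟩ ≤ 5 * wallClock γ y) ∧
      -- in particular with a depth of order `depthScale`, a vanishing fraction of sequential depth
      (∀ κ : ℝ, 0 < κ → ∀ᶠ ε in 𝓝[>] (0 : ℝ), ∃ n b : ℕ, 1 < b ∧
        n ≤ 5 * depthScale P ε ∧
        (⟨n, b, 1⟩ : Design) ∈ feasible P β integerCounts ε ∧
        (∀ y ∈ feasible P β continuousCounts ε, wallClock γ ⟨n, b, 1⟩ ≤ 5 * wallClock γ y) ∧
        ∀ n' : ℕ, (⟨n', 1, 1⟩ : Design) ∈ feasible P β integerCounts ε → n ≤ κ * n')) := by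
  have hβ1 : 1 < β := by linarith
  refine ⟨fun hγ2 => ?_, fun hγ2 P => ?_⟩
  · have hasymp : ∀ P : ProblemConstants, ∀ S : Set ℝ,
        (S = integerCounts ∨ S = continuousCounts) → ∀ η : ℝ, 0 < η →
        ∀ᶠ ε in 𝓝[>] (0 : ℝ), ∀ x, IsOptimal P β γ S ε x →
          |x.N / leadN P β γ ε - 1| ≤ η ∧ |x.δ / leadδ P β γ ε - 1| ≤ η ∧
          |wallClock γ x / (timeScale P β γ ε *
            (depthFactor β γ * fidelityFactor β γ ^ (-γ))) - 1| ≤ η := by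
      intro P S hS η hη
      rw [← eventually_optimaFilter (P := P) (S := S) (β := β) (γ := γ)
        (Q := fun ε x => |x.N / leadN P β γ ε - 1| ≤ η ∧ |x.δ / leadδ P β γ ε - 1| ≤ η ∧
          |wallClock γ x / (timeScale P β γ ε *
            (depthFactor β γ * fidelityFactor β γ ^ (-γ))) - 1| ≤ η)]
      filter_upwards [abs_sub_one_le_of_tendsto (tendsto_depth_div_leadN hβ1 hγ hγ2 hS) hη,
        abs_sub_one_le_of_tendsto (tendsto_fidelity_div_leadδ hβ1 hγ hγ2 hS) hη,
        abs_sub_one_le_of_tendsto (tendsto_wallClock_div hβ1 hγ hγ2 hS) hη] with p h1 h2 h3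
      exact ⟨h1, h2, h3⟩
    refine ⟨fun P S hS => ⟨fun ε hε => ⟨exists_isOptimal P hβ1 hγ hε hS,
      fun x hx => hx.sequential hβ1 hγ2 hε hS⟩, hasymp P S hS⟩, ?_⟩
    have hU := limitDepthShare_pos hβ1 hγ hγ2
    have hV := limitNoiseShare_pos hβ1 hγ hγ2
    have hC : 0 < fidelityFactor β γ := by
      rw [fidelityFactor_eq hβ1 hγ hγ2]; positivity
    have hF : 0 < depthFactor β γ * fidelityFactor β γ ^ (-γ) := by
      rw [← relativeCost_limit hβ1 hγ hγ2]
      exact relativeCost_pos hU hV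
    set F := depthFactor β γ * fidelityFactor β γ ^ (-γ)
    -- The true constant is `F / fidelityFactor β γ`; lose a factor `1 ± 1 / 2` around it.
    refine ⟨1 / 2 * (F / fidelityFactor β γ), 3 / 2 * (F / fidelityFactor β γ), by positivity,
      by positivity, fun P S hS => ?_⟩
    filter_upwards [self_mem_nhdsWithin, hasymp P S hS (1 / 2) (by norm_num)] with ε hε h x hx
    have hT := timeScale_pos P β γ (show 0 < ε from hε)
    obtain ⟨hlo, hhi⟩ := abs_le.1 (h x hx).2.2
    have hlo : 1 / 2 ≤ wallClock γ x / (timeScale P β γ ε * F) := by linarith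
    have hhi : wallClock γ x / (timeScale P β γ ε * F) ≤ 3 / 2 := by linarith
    rw [le_div_iff₀ (by positivity)] at hlo
    rw [div_le_iff₀ (by positivity)] at hhi
    have e : ∀ r : ℝ, r * (F / fidelityFactor β γ) * (timeScale P β γ ε * fidelityFactor β γ) =
        r * (timeScale P β γ ε * F) := by
      intro r; field_simp
    rw [e, e]
    exact ⟨hlo, hhi⟩
  · have hlow : ∀ ε : ℝ, 0 < ε → ∀ y ∈ feasible P β continuousCounts ε,
        coarseTime P β ε ≤ wallClock γ y :=
      fun ε hε y hy => coarseTime_le_wallClock hβ1 hγ2 hε (Or.inr rfl) hy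
    refine ⟨fun ε hε => ⟨exists_isOptimal P hβ1 hγ hε (Or.inr rfl),
      fun x hx => hx.full_fidelity_sequential hβ1 hγ2 hε⟩,
      fun S hS => ⟨fun ε hε => exists_isOptimal P hβ1 hγ hε hS, fun η hη => ?_⟩,
      fun η hη => ?_, ?_, fun κ hκ => ?_⟩
    · filter_upwards [self_mem_nhdsWithin, eventually_exists_sequential P hβ1 hη]
        with ε hε h x hx
      have hε : 0 < ε := hε
      have hT := coarseTime_pos P β hε
      obtain ⟨n, ⟨⟨k, hk, hnk⟩, -, hδ, hδ1, hE⟩, hnη⟩ := h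
      have hnS : (n : ℝ) ∈ S := by
        simp only at hnk
        rw [hnk]
        exact natCast_mem_counts hS hk
      have h1 := hx.2 ⟨n, 1, 1⟩ ⟨hnS, one_mem_counts hS, hδ, hδ1, hE⟩
      rw [wallClock_full_fidelity, one_mul] at h1
      have h2 := coarseTime_le_wallClock hβ1 hγ2 hε hS hx.1
      rw [abs_of_nonneg (by rw [sub_nonneg, one_le_div hT]; exact h2), sub_le_iff_le_add,
        div_le_iff₀ hT]
      linarith
    · filter_upwards [self_mem_nhdsWithin, eventually_exists_sequential P hβ1 hη] with ε hε h
      obtain ⟨n, hn, hnη⟩ := h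
      refine ⟨n, hn, fun y hy => ?_⟩
      rw [wallClock_full_fidelity, one_mul]
      exact hnη.trans (mul_le_mul_of_nonneg_left (hlow ε hε y hy) (by linarith))
    · filter_upwards [self_mem_nhdsWithin, eventually_exists_batched P hβ] with ε hε h n h1 h2
      obtain ⟨b, hb, hf, hc⟩ := h n h1 h2
      refine ⟨b, hb, hf, fun y hy => ?_⟩
      rw [wallClock_full_fidelity]
      exact hc.trans (mul_le_mul_of_nonneg_left (hlow ε hε y hy) (by norm_num))
    · filter_upwards [self_mem_nhdsWithin, eventually_exists_shallow_batched P hβ hκ]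
        with ε hε h
      obtain ⟨n, b, hb, hn, hf, hc, hκn⟩ := h
      refine ⟨n, b, hb, hn, hf, fun y hy => ?_, fun n' hn' => hκn.trans ?_⟩
      · rw [wallClock_full_fidelity]
        exact hc.trans (mul_le_mul_of_nonneg_left (hlow ε hε y hy) (by norm_num))
      · have h1 := coarseTime_le_wallClock hβ1 hγ2 hε (Or.inl rfl) hn'
        rw [wallClock_full_fidelity, one_mul] at h1
        exact mul_le_mul_of_nonneg_left h1 hκ.le
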